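/- Let $B$ be a stationary Bratteli diagram: every level $n\ge 1$ is a copy of a finite vertex set $V$, the edges from level $n$ to level $n+1$ form the same finite multigraph for all $n\ge 1$, every vertex emits an edge, every vertex of level $\ge 2$ receives an edge, and the single vertex $v_0$ of level $0$ is joined to each vertex of level $1$ by exactly one edge. Let $F=(f_{vw})$ be its incidence matrix ($f_{vw}$ is the number of edges with range $v$ and source $w$), $A=F^T$, and let $X_B$ be the space of infinite paths starting at $v_0$, with the topology generated by the cylinder sets. Let $\lambda$ be a distinguished eigenvalue of $A$, i.e. an eigenvalue with a non-negative eigenvector, let $y=(y_v)_{v\in V}$ be a non-negative vector with $Ay=\lambda y$ and $\sum_v y_v=1$, and let $\mu$ be the Borel probability measure on $X_B$ defined by $\lambda$ and $y$: a cylinder set given by a finite path from $v_0$ to the vertex $v$ of level $n\ge1$ has measure $y_v/\lambda^{n-1}$. Consider $\mu$ as a measure on its topological support $X=\operatorname{supp}\mu$, and assume that every path in $X$ is tail equivalent to infinitely many paths (two paths are tail equivalent if they differ in only finitely many edges). Let $S(\mu)=\{\mu(U): U\text{ clopen in }X\}$, and assume that $\mu$ is rational, i.e. $S(\mu)\subset\mathbb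 Q$. Let $(\frac{p_1}{q},\dots,\frac{p_n}{q})$ be the reduced vector, i.e. the vector of non-zero entries of $y$, written with positive integers $p_i,q$ such that $\gcd(p_1,\dots,p_n)=1$. Then $\lambda$ is a positive integer, and: (1) A real number $t$ lies in $S(\mu)+\mathbb Z$ if and only if $t\lambda^N q\in\mathbb Z$ for some $N\in\mathbb N$. (2) $S(\mu)$ is multiplicative (closed under products) if and only if $q\mid\lambda^K$ for some $K\in\mathbb N$. (3) If $\mu$ is good, then $\mu$ is of Bernoulli type if and only if $q\mid\lambda^K$ for some $K\in\mathbb N$. Here $\mu$ is good if for all clopen $U,V\subset X$ with $\mu(U)<\mu(V)$ there is a clopen $W\subset V$ with $\mu(W)=\mu(U)$. The measure $\mu$ is of Bernoulli type if there is a collection $\mathcal B$ of non-empty clopen subsets of $X$ such that every non-empty clopen subset of $X$ can be partitioned into members of $\mathcal B$, and for every $U\in\mathcal B$ the relative measure $\mu_U(\cdot)=\mu(\,\cdot\cap U)/\mu(U)$ satisfies $S(\mu_U)=S(\mu)$. -/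

import Mathlib

open MeasureTheory

/-- A stationary Bratteli diagram. Every level `n ≥ 1` is a copy of the finite vertex set `V`, and
for `n ≥ 1` the edges from level `n` to level `n + 1` form a copy of the finite set `E`. The level
`0` is one vertex `v₀`, joined to each vertex of level `1` by exactly one edge. -/
structure StationaryBratteliDiagram (V E : Type*) where
  /-- the source map -/
  source : E → V
  /-- the range map -/
  range : E → V
  /-- every vertex emits an edge -/
  source_surjective : Function.Surjective source
  /-- every vertex of level at least `2` receives an edge -/
  range_surjective : Function.Surjective range

namespace StationaryBratteliDiagram

variable {V E : Type*}

/-- The incidence matrix `F`: the entry at `(v, w)` is the number of edges with range `v` and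
source `w`. -/
noncomputable def incidence (B : StationaryBratteliDiagram V E) : Matrix V V ℕ :=
  fun v w => Nat.card {e : E // B.range e = v ∧ B.source e = w}

/-- The path space `X_B`: the infinite paths that start at `v₀`. The entry `edge n` joins level
`n + 1` to level `n + 2`; the edge from `v₀` to level `1` is not listed, because it is the only
edge from `v₀` to `source (edge 0)`. -/
@[ext] structure PathSpace (B : StationaryBratteliDiagram V E) where
  /-- the edges of the path, from level `1` on -/
  edge : ℕ → E
  /-- consecutive edges are composable -/
  composable : ∀ n, B.range (edge n) = B.source (edge (n + 1))

/-- The vertex of level `n + 1` through which a path passes. -/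
def PathSpace.vertex {B : StationaryBratteliDiagram V E} (x : B.PathSpace) (n : ℕ) : V :=
  B.source (x.edge n)

/-- The cylinder set of all paths that agree with `x` from `v₀` down to level `n + 1`: same edge
from `v₀`, and the same `n` edges after it. As every vertex emits an edge, every finite path
from `v₀` to level `n + 1` is an initial segment of some `x`, and so these are all the
cylinder sets. -/
def cylinder {B : StationaryBratteliDiagram V E} (x : B.PathSpace) (n : ℕ) : Set B.PathSpace :=
  {x' | x'.vertex 0 = x.vertex 0 ∧ ∀ i < n, x'.edge i = x.edge i}

/-- The topology generated by the cylinder sets. -/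
instance (B : StationaryBratteliDiagram V E) : TopologicalSpace B.PathSpace :=
  TopologicalSpace.generateFrom {C | ∃ (x : B.PathSpace) (n : ℕ), C = cylinder x n}

/-- The Borel σ-algebra of the path space. -/
instance (B : StationaryBratteliDiagram V E) : MeasurableSpace B.PathSpace :=
  borel B.PathSpace

instance (B : StationaryBratteliDiagram V E) : BorelSpace B.PathSpace := ⟨rfl⟩

/-- Tail equivalence of paths. -/
def TailEquiv {B : StationaryBratteliDiagram V E} (x x' : B.PathSpace) : Prop :=
  ∃ i₀, ∀ i ≥ i₀, x.edge i = x'.edge i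

/-- `y` is a probability eigenvector of `A = Fᵀ` (non-negative entries with sum `1`) for the
eigenvalue `lam`. In particular `lam` is then a distinguished eigenvalue of `A`. -/
structure IsProbabilityEigenvector [Fintype V] (B : StationaryBratteliDiagram V E)
    (lam : ℝ) (y : V → ℝ) : Prop where
  nonneg : ∀ v, 0 ≤ y v
  sum_eq_one : ∑ v, y v = 1
  eigen : (B.incidence.map (Nat.cast : ℕ → ℝ)).transpose.mulVec y = lam • y

/-- `μ` is the measure defined by the eigenvalue `lam` and the eigenvector `y`: a cylinder set
given by a finite path from `v₀` to the vertex `v` of level `n + 1` has measure `y v / lam ^ n`. -/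
def IsDefinedBy {B : StationaryBratteliDiagram V E} (μ : Measure B.PathSpace)
    (lam : ℝ) (y : V → ℝ) : Prop :=
  ∀ (x : B.PathSpace) (n : ℕ), μ (cylinder x n) = ENNReal.ofReal (y (x.vertex n) / lam ^ n)

end StationaryBratteliDiagram

/-- `x` is the reduced vector of `y`: the zero entries of `y` are crossed out and the others are
numbered by `Fin n`. -/
def IsReducedVector {V : Type*} {n : ℕ} (y : V → ℝ) (x : Fin n → ℝ) : Prop :=
  ∃ f : Fin n ≃ {v : V // y v ≠ 0}, ∀ i, x i = y (f i)

namespace MeasureTheory.Measure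

variable {X : Type*} [TopologicalSpace X] [MeasurableSpace X]

/-- The measure `μ`, considered on its topological support. -/
noncomputable def onSupport (μ : Measure X) : Measure μ.support :=
  μ.comap Subtype.val

/-- The clopen values set `S(μ)`. -/
def clopenValues (μ : Measure X) : Set ℝ :=
  {t | ∃ U : Set X, IsClopen U ∧ μ.real U = t}

/-- `μ` is rational: all its clopen values are rational numbers. -/
def IsRational (μ : Measure X) : Prop :=
  μ.clopenValues ⊆ Set.range (Rat.cast : ℚ → ℝ)

/-- `μ` is good: if `U`, `V` are clopen and `μ U < μ V`, then `V` has a clopen subset of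
measure `μ U`. -/
def IsGood (μ : Measure X) : Prop :=
  ∀ V : Set X, IsClopen V → ∀ U : Set X, IsClopen U → μ U < μ V →
    ∃ W : Set X, IsClopen W ∧ W ⊆ V ∧ μ W = μ U

/-- `U` is a (non-empty) clopen set of `μ` type: the relative measure `A ↦ μ (U ∩ A) / μ U` has
the same clopen values set as `μ`. -/
def IsOfMeasureType (μ : Measure X) (U : Set X) : Prop :=
  IsClopen U ∧ U.Nonempty ∧ (ProbabilityTheory.cond μ U).clopenValues = μ.clopenValues

end MeasureTheory.Measure

/-- A partition basis: a collection of clopen sets such that every non-empty clopen set can be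
partitioned by members of the collection. -/
def IsPartitionBasis {X : Type*} [TopologicalSpace X] (𝓑 : Set (Set X)) : Prop :=
  (∀ U ∈ 𝓑, IsClopen U) ∧
    ∀ U : Set X, IsClopen U → U.Nonempty →
      ∃ P : Set (Set X), P ⊆ 𝓑 ∧ P.PairwiseDisjoint id ∧ ⋃₀ P = U

/-- `μ` is of Bernoulli type: some partition basis consists of clopen sets of `μ` type. -/
def MeasureTheory.Measure.IsOfBernoulliType {X : Type*} [TopologicalSpace X] [MeasurableSpace X]
    (μ : Measure X) : Prop :=
  ∃ 𝓑 : Set (Set X), IsPartitionBasis 𝓑 ∧ ∀ U ∈ 𝓑, μ.IsOfMeasureType U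

/-! Everything follows from $S(\mu)=[0,1]\cap\frac1q\mathbb Z[1/\lambda]$
(`clopenValues_onSupport`). That $\lambda$ is an integer comes first: the eigenvector equation makes
every $\lambda p_i$ an integer, and Bézout's identity $\sum a_ip_i=1$ gives $\lambda=\sum
a_i(\lambda p_i)$.

The support consists of the paths that avoid the zeros of $y$, and by compactness a clopen set is a
finite union of cylinders of one level. So its measure is $\sum k_ip_i/(\lambda^Nq)$ with $0\le
k_i\le h_i$, where the height $h_i$ counts the cylinders that end at the $i$-th vertex, and $\sum
h_ip_i=\lambda^Nq$. Conversely, infinite tail classes force all heights to infinity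
(`exists_le_height`), and since $\gcd(p_i)=1$, bounded coefficients $k_i\le h_i$ reach every integer
that is not too near $0$ or $\lambda^Nq$ (`exists_bounded_sum_mul_eq`). For $0<t<1$, passing to a
deeper level multiplies the numerator and its distance to the total by a power of $\lambda$, so both
ends are avoided.

If $q\mid\lambda^K$, the group is the ring $\mathbb Z[1/\lambda]$; goodness then splits every clopen
set into pieces of measure $\lambda^{-M}$, which are of $\mu$ type. In the other direction,
multiplicativity or the Bernoulli property puts $1/q^2$ into the group, and this forces
$q\mid\lambda^K$. -/

/-! ### Bounded representations of integers by a linear form -/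

/-- A linear form with coefficients at most `Q` takes values within `Q` of any number between its
values at the lower and at the upper corner of a box of natural numbers. -/
theorem exists_box_sum_mul_near {ι : Type*} [Fintype ι] (p lo hi : ι → ℕ) (Q : ℕ)
    (hQ : ∀ i, p i ≤ Q) (hle : ∀ i, lo i ≤ hi i) (z : ℕ) (hz : ∑ i, lo i * p i ≤ z)
    (hz' : z ≤ ∑ i, hi i * p i) :
    ∃ k : ι → ℕ, (∀ i, lo i ≤ k i ∧ k i ≤ hi i) ∧ ∑ i, k i * p i ≤ z ∧
      z ≤ ∑ i, k i * p i + Q := by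
  classical
  induction z, hz using Nat.le_induction with
  | base => exact ⟨lo, fun i => ⟨le_rfl, hle i⟩, le_rfl, Nat.le_add_right _ _⟩
  | succ z hz ih =>
    obtain ⟨k, hk, h1, h2⟩ := ih (by omega)
    by_cases h : z + 1 ≤ ∑ i, k i * p i + Q
    · exact ⟨k, hk, by omega, h⟩
    -- Here the sum lags behind `z` by exactly `Q`. Raising a coordinate with `0 < p j ≤ Q` catches
    -- up without overshooting.
    · have hlt : ∑ i, k i * p i < ∑ i, hi i * p i := by omega
      obtain ⟨j, -, hj⟩ := Finset.exists_lt_of_sum_lt hlt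
      have hj' : k j < hi j := lt_of_mul_lt_mul_right hj (Nat.zero_le _)
      have hsum : ∑ i, (k + Pi.single j 1 : ι → ℕ) i * p i = ∑ i, k i * p i + p j := by
        simp [add_mul, Finset.sum_add_distrib, Pi.single_apply]
      have hpj : 0 < p j := Nat.pos_of_ne_zero fun h0 => by simp [h0] at hj
      refine ⟨k + Pi.single j 1, fun i => ?_, ?_, ?_⟩
      · have := hk i
        by_cases hij : i = j
        · subst hij
          simp; omega
        · simp [hij]; omega
      · rw [hsum]; have := hQ j; omega
      · rw [hsum]; omega

theorem exists_int_sum_mul_eq_one {ι : Type*} [Fintype ι] (p : ι → ℕ)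
    (hgcd : Finset.univ.gcd p = 1) : ∃ a : ι → ℤ, ∑ i, a i * (p i : ℤ) = 1 := by
  obtain ⟨a, ha⟩ := Finset.gcd_eq_sum_mul Finset.univ (fun i => (p i : ℤ))
  refine ⟨a, ?_⟩
  have h : Finset.univ.gcd (fun i => (p i : ℤ)) ∣ 1 := by
    have key : ((Finset.univ.gcd (fun i => (p i : ℤ))).natAbs) ∣ Finset.univ.gcd p := by
      refine Finset.dvd_gcd fun i _ => ?_
      have := Finset.gcd_dvd (f := fun i => (p i : ℤ)) (Finset.mem_univ i)
      exact Int.natAbs_dvd_natAbs.mpr this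
    rw [hgcd] at key
    exact Int.natAbs_dvd_natAbs.mp key
  have h1 : Finset.univ.gcd (fun i => (p i : ℤ)) = 1 := by
    rw [← Finset.normalize_gcd]
    exact normalize_eq_one.mpr (isUnit_of_dvd_one h)
  rw [← h1, ha]
  exact Finset.sum_congr rfl fun i _ => mul_comm _ _

/-- A bounded form of the Frobenius coin theorem. -/
theorem exists_bounded_sum_mul_eq {ι : Type*} [Fintype ι] (p : ι → ℕ)
    (hgcd : Finset.univ.gcd p = 1) :
    ∃ C : ℕ, ∀ h : ι → ℕ, (∀ i, C ≤ h i) → ∀ z : ℕ, C ≤ z → z + C ≤ ∑ i, h i * p i →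
      ∃ k : ι → ℕ, (∀ i, k i ≤ h i) ∧ ∑ i, k i * p i = z := by
  obtain ⟨a, ha⟩ := exists_int_sum_mul_eq_one p hgcd
  set Q := ∑ i, p i with hQ
  set M := Q * ∑ i, (a i).natAbs with hM
  -- `2 * M` leaves a margin `M` on both sides of each coordinate, and `M * Q` is the value of the
  -- form on that margin. A remainder `r ≤ Q` is then absorbed by adding `r * a i`, of absolute
  -- value at most `M`.
  refine ⟨2 * M + M * Q, fun h hh z hz hz' => ?_⟩
  have hh' : ∀ i, 2 * M ≤ h i := fun i => le_trans (Nat.le_add_right _ _) (hh i)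
  have hlo : ∑ i, M * p i = M * Q := by rw [hQ, Finset.mul_sum]
  have hhi : ∑ i, (h i - M) * p i + M * Q = ∑ i, h i * p i := by
    rw [← hlo, ← Finset.sum_add_distrib]
    refine Finset.sum_congr rfl fun i _ => ?_
    rw [← add_mul, Nat.sub_add_cancel (by have := hh' i; omega)]
  obtain ⟨k, hk, h1, h2⟩ := exists_box_sum_mul_near p (fun _ => M) (fun i => h i - M) Q
    (fun i => Finset.single_le_sum (f := p) (fun _ _ => Nat.zero_le _) (Finset.mem_univ i))
    (fun i => by have := hh' i; omega) z (by omega) (by omega)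
  obtain ⟨r, hr⟩ := Nat.exists_eq_add_of_le h1
  have hrQ : r ≤ Q := by omega
  have hb : ∀ i, |(r : ℤ) * a i| ≤ M := by
    intro i
    have h3 : (a i).natAbs ≤ ∑ i, (a i).natAbs :=
      Finset.single_le_sum (f := fun i => (a i).natAbs) (fun _ _ => Nat.zero_le _)
        (Finset.mem_univ i)
    have h4 : r * (a i).natAbs ≤ M := Nat.mul_le_mul hrQ h3
    rw [abs_mul, Nat.abs_cast, Int.abs_eq_natAbs]
    exact_mod_cast h4
  have hk' : ∀ i, 0 ≤ (k i : ℤ) + r * a i := fun i => by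
    have := abs_le.mp (hb i); have := hk i; omega
  refine ⟨fun i => ((k i : ℤ) + r * a i).toNat, fun i => ?_, ?_⟩
  · have := abs_le.mp (hb i); have := hk i; have := hh' i; have := hk' i
    beta_reduce; omega
  · zify
    have : ∀ i, ((((k i : ℤ) + r * a i).toNat : ℕ) : ℤ) * (p i : ℤ)
        = (k i : ℤ) * p i + r * (a i * p i) := fun i => by
      rw [Int.toNat_of_nonneg (hk' i)]; ring
    simp_rw [this]
    rw [Finset.sum_add_distrib, ← Finset.mul_sum, ha, hr]
    push_cast
    ring

/-! ### The group `ℤ[1/l] / q` and its unit interval -/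

/-- The additive group `ℤ[1/l] / q`. -/
def fracGroup (l q : ℕ) : Set ℝ := {t | ∃ N : ℕ, ∃ z : ℤ, t * (l : ℝ) ^ N * (q : ℝ) = (z : ℝ)}

theorem add_int_mem_fracGroup {l q : ℕ} {t : ℝ} (ht : t ∈ fracGroup l q) (k : ℤ) :
    t + k ∈ fracGroup l q := by
  obtain ⟨N, z, h⟩ := ht
  refine ⟨N, z + k * l ^ N * q, ?_⟩
  push_cast
  rw [← h]; ring

theorem exists_add_int_iff_mem_fracGroup {l q : ℕ} (t : ℝ) :
    (∃ s ∈ Set.Icc (0 : ℝ) 1 ∩ fracGroup l q, ∃ k : ℤ, t = s + (k : ℝ)) ↔ t ∈ fracGroup l q := by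
  constructor
  · rintro ⟨s, ⟨-, hs⟩, k, rfl⟩
    exact add_int_mem_fracGroup hs k
  · intro ht
    refine ⟨Int.fract t, ⟨⟨Int.fract_nonneg t, (Int.fract_lt_one t).le⟩, ?_⟩, ⌊t⌋, ?_⟩
    · have := add_int_mem_fracGroup ht (-⌊t⌋)
      rwa [Int.cast_neg, ← sub_eq_add_neg] at this
    · exact (Int.fract_add_floor t).symm

/-- Clearing denominators in $q^{-2}\,l^N q=z$ gives $l^N=qz$. Both the multiplicative and the
Bernoulli criterion reduce to this test. -/
theorem exists_dvd_pow_of_inv_mul_inv_mem {l q : ℕ} (hq : 0 < q)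
    (h : (q : ℝ)⁻¹ * (q : ℝ)⁻¹ ∈ fracGroup l q) : ∃ K : ℕ, q ∣ l ^ K := by
  obtain ⟨N, z, h⟩ := h
  have hq' : (q : ℝ) ≠ 0 := by positivity
  have h2 : (l : ℝ) ^ N = q * z := by
    field_simp at h
    linarith
  refine ⟨N, ?_⟩
  have h3 : ((l ^ N : ℕ) : ℤ) = (q : ℤ) * z := by exact_mod_cast h2
  exact Int.natCast_dvd_natCast.mp ⟨z, h3⟩

/-- Since $q$ divides a power of $l$, it is already invertible in $\mathbb Z[1/l]$, so dividing by
it adds nothing. -/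
theorem mem_fracGroup_iff_of_dvd {l q K : ℕ} (hq : 0 < q) (hl : 0 < l) (h : q ∣ l ^ K) (t : ℝ) :
    t ∈ fracGroup l q ↔ ∃ M : ℕ, ∃ z : ℤ, t = z / (l : ℝ) ^ M := by
  have hl' : (l : ℝ) ≠ 0 := by positivity
  have hq' : (q : ℝ) ≠ 0 := by positivity
  constructor
  · rintro ⟨N, z, hz⟩
    obtain ⟨m, hm⟩ := h
    have hm' : (l : ℝ) ^ K = q * m := by exact_mod_cast hm
    refine ⟨N + K, z * m, ?_⟩
    rw [eq_div_iff (by positivity), pow_add, hm']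
    push_cast
    rw [← hz]; ring
  · rintro ⟨M, z, rfl⟩
    refine ⟨M, z * q, ?_⟩
    push_cast
    field_simp

theorem inv_natCast_mem {l q : ℕ} (hq : 0 < q) :
    (q : ℝ)⁻¹ ∈ Set.Icc (0 : ℝ) 1 ∩ fracGroup l q := by
  refine ⟨⟨by positivity, inv_le_one_of_one_le₀ (by exact_mod_cast hq)⟩, 0, 1, ?_⟩
  have hq' : (q : ℝ) ≠ 0 := by positivity
  simp [hq']

theorem mul_mem_fracGroup_iff {l q : ℕ} (hq : 0 < q) (hl : 0 < l) :
    (∀ s ∈ Set.Icc (0 : ℝ) 1 ∩ fracGroup l q, ∀ t ∈ Set.Icc (0 : ℝ) 1 ∩ fracGroup l q,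
      s * t ∈ Set.Icc (0 : ℝ) 1 ∩ fracGroup l q) ↔ ∃ K : ℕ, q ∣ l ^ K := by
  constructor
  · intro h
    exact exists_dvd_pow_of_inv_mul_inv_mem hq
      (h _ (inv_natCast_mem hq) _ (inv_natCast_mem hq)).2
  · rintro ⟨K, hK⟩ s ⟨hs, hs'⟩ t ⟨ht, ht'⟩
    refine ⟨⟨mul_nonneg hs.1 ht.1, mul_le_one₀ hs.2 ht.1 ht.2⟩, ?_⟩
    rw [mem_fracGroup_iff_of_dvd hq hl hK] at hs' ht' ⊢
    obtain ⟨M, z, rfl⟩ := hs'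
    obtain ⟨M', z', rfl⟩ := ht'
    exact ⟨M + M', z * z', by push_cast; rw [div_mul_div_comm, pow_add]⟩

/-! ### Good measures and Bernoulli type -/

namespace MeasureTheory.Measure

variable {X : Type*} [TopologicalSpace X] [MeasurableSpace X]

theorem real_cond_apply [BorelSpace X] (ν : Measure X) [IsFiniteMeasure ν] {U : Set X}
    (hU : IsClopen U) (W : Set X) :
    (ProbabilityTheory.cond ν U).real W = ν.real (U ∩ W) / ν.real U := by
  rw [measureReal_def, ProbabilityTheory.cond_apply hU.isOpen.measurableSet, ENNReal.toReal_mul,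
    ENNReal.toReal_inv, inv_mul_eq_div]
  rfl

theorem exists_isClopen_subset_of_le {ν : Measure X} [IsFiniteMeasure ν] (hg : ν.IsGood)
    {U : Set X} (hU : IsClopen U) {t : ℝ} (ht : t ∈ ν.clopenValues) (htU : t ≤ ν.real U) :
    ∃ W, IsClopen W ∧ W ⊆ U ∧ ν.real W = t := by
  obtain ⟨W, hW, rfl⟩ := ht
  rcases htU.lt_or_eq with h | h
  · obtain ⟨W', h1, h2, h3⟩ := hg U hU W hW
      ((ENNReal.toReal_lt_toReal (measure_ne_top _ _) (measure_ne_top _ _)).mp h)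
    exact ⟨W', h1, h2, by rw [measureReal_def, h3, measureReal_def]⟩
  · exact ⟨U, hU, subset_rfl, h.symm⟩

/-- Under a good measure whose clopen values form the unit interval of `ℤ[1/l]`, a clopen set of
measure `m / l ^ M` splits into `m` clopen sets of measure `1 / l ^ M`. -/
theorem exists_partition_of_isGood [BorelSpace X] {ν : Measure X} [IsProbabilityMeasure ν]
    [ν.IsOpenPosMeasure] (hg : ν.IsGood) {l M : ℕ} (hl : 0 < l)
    (hM : 1 / (l : ℝ) ^ M ∈ ν.clopenValues) (m : ℕ) (U : Set X) (hU : IsClopen U)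
    (hm : ν.real U = m / (l : ℝ) ^ M) :
    ∃ P : Set (Set X), (∀ W ∈ P, IsClopen W ∧ ν.real W = 1 / (l : ℝ) ^ M) ∧
      P.PairwiseDisjoint id ∧ ⋃₀ P = U := by
  induction m generalizing U with
  | zero =>
    refine ⟨∅, by simp, by simp, ?_⟩
    have h0 : ν U = 0 := by
      simpa [measureReal_def, ENNReal.toReal_eq_zero_iff] using hm
    simp [(hU.isOpen.measure_eq_zero_iff ν).mp h0]
  | succ m ih =>
    have hl' : (0 : ℝ) < (l : ℝ) ^ M := by positivity
    obtain ⟨W, hW, hWU, hWm⟩ := exists_isClopen_subset_of_le hg hU hM (by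
      rw [hm]; gcongr; push_cast; linarith [(Nat.cast_nonneg m : (0 : ℝ) ≤ m)])
    obtain ⟨P, hP, hd, hs⟩ := ih (U \ W) (hU.diff hW) (by
      rw [measureReal_sdiff hWU hW.isOpen.measurableSet, hm, hWm]; push_cast; ring)
    refine ⟨insert W P, ?_, ?_, ?_⟩
    · rintro V (rfl | hV)
      · exact ⟨hW, hWm⟩
      · exact hP V hV
    · refine hd.insert fun V hV _ => ?_
      have : V ⊆ U \ W := hs ▸ Set.subset_sUnion_of_mem hV
      exact (Set.disjoint_sdiff_right (s := W) (t := U)).mono_right this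
    · rw [Set.sUnion_insert, hs, Set.union_sdiff_cancel hWU]

/-- The basis consists of the clopen sets of measure $l^{-M}$. Relative measure in such a set is
multiplication by $l^M$, which preserves $\mathbb Z[1/l]$; goodness realises all values inside the
set. -/
theorem isOfBernoulliType_of_dvd [BorelSpace X] {ν : Measure X} [IsProbabilityMeasure ν]
    [ν.IsOpenPosMeasure] (hg : ν.IsGood) {l q K : ℕ} (hl : 0 < l) (hq : 0 < q) (hK : q ∣ l ^ K)
    (hS : ν.clopenValues = Set.Icc (0 : ℝ) 1 ∩ fracGroup l q) : ν.IsOfBernoulliType := by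
  have hl1 : (1 : ℝ) ≤ l := by exact_mod_cast hl
  have hM : ∀ M : ℕ, 1 / (l : ℝ) ^ M ∈ ν.clopenValues := fun M => by
    rw [hS]
    refine ⟨⟨by positivity, ?_⟩, (mem_fracGroup_iff_of_dvd hq hl hK _).mpr ⟨M, 1, by simp⟩⟩
    rw [div_le_one (by positivity)]
    exact one_le_pow₀ hl1
  refine ⟨{U | IsClopen U ∧ ∃ M : ℕ, ν.real U = 1 / (l : ℝ) ^ M}, ⟨fun U hU => hU.1, ?_⟩, ?_⟩
  · intro U hU _
    have hUS : ν.real U ∈ ν.clopenValues := ⟨U, hU, rfl⟩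
    rw [hS] at hUS
    obtain ⟨M, z, hz⟩ := (mem_fracGroup_iff_of_dvd hq hl hK _).mp hUS.2
    have hz0 : 0 ≤ z := by
      have h1 := hUS.1.1
      rw [hz, le_div_iff₀ (by positivity)] at h1
      exact_mod_cast (by linarith : (0 : ℝ) ≤ z)
    lift z to ℕ using hz0
    obtain ⟨P, hP, h⟩ := exists_partition_of_isGood hg hl (hM M) z U hU (by simpa using hz)
    exact ⟨P, fun W hW => ⟨(hP W hW).1, M, (hP W hW).2⟩, h⟩
  · rintro U ⟨hU, M, hUM⟩
    have hl' : (0 : ℝ) < (l : ℝ) ^ M := by positivity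
    refine ⟨hU, ?_, Set.Subset.antisymm ?_ ?_⟩
    · rw [Set.nonempty_iff_ne_empty]
      rintro rfl
      rw [measureReal_empty] at hUM
      exact absurd hUM (by positivity)
    · rintro _ ⟨W, hW, rfl⟩
      have hUW : ν.real (U ∩ W) ∈ ν.clopenValues := ⟨U ∩ W, hU.inter hW, rfl⟩
      rw [real_cond_apply ν hU]
      have hle : ν.real (U ∩ W) ≤ ν.real U := measureReal_mono Set.inter_subset_left
      rw [hS] at hUW ⊢
      refine ⟨⟨by positivity, div_le_one_of_le₀ hle (by positivity)⟩, ?_⟩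
      obtain ⟨M', z, hz⟩ := (mem_fracGroup_iff_of_dvd hq hl hK _).mp hUW.2
      refine (mem_fracGroup_iff_of_dvd hq hl hK _).mpr ⟨M', z * l ^ M, ?_⟩
      rw [hz, hUM]
      push_cast
      field_simp
    · intro t ht
      have ht' := ht
      rw [hS] at ht'
      have htM : t / (l : ℝ) ^ M ∈ ν.clopenValues := by
        rw [hS]
        refine ⟨⟨div_nonneg ht'.1.1 hl'.le,
          div_le_one_of_le₀ (ht'.1.2.trans (one_le_pow₀ hl1)) hl'.le⟩, ?_⟩
        obtain ⟨M', z, hz⟩ := (mem_fracGroup_iff_of_dvd hq hl hK _).mp ht'.2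
        exact (mem_fracGroup_iff_of_dvd hq hl hK _).mpr
          ⟨M' + M, z, by rw [hz, div_div, pow_add]⟩
      obtain ⟨W, hW, hWU, hWt⟩ := exists_isClopen_subset_of_le hg hU htM (by
        rw [hUM]; gcongr; exact ht'.1.2)
      refine ⟨W, hW, ?_⟩
      rw [real_cond_apply ν hU, Set.inter_eq_right.mpr hWU, hWt, hUM]
      field_simp

/-- If a clopen set is of `ν` type, then multiplication by its measure preserves the clopen
values set. -/
theorem real_mul_mem_clopenValues [BorelSpace X] {ν : Measure X} [IsFiniteMeasure ν]
    {U : Set X} (hU : ν.IsOfMeasureType U) {t : ℝ} (ht : t ∈ ν.clopenValues) :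
    ν.real U * t ∈ ν.clopenValues := by
  obtain ⟨hUc, -, hUS⟩ := hU
  rw [← hUS] at ht
  obtain ⟨W, hW, rfl⟩ := ht
  refine ⟨U ∩ W, hUc.inter hW, ?_⟩
  rw [real_cond_apply ν hUc]
  rcases eq_or_ne (ν.real U) 0 with h | h
  · have := measureReal_mono (μ := ν) (Set.inter_subset_left (s := U) (t := W))
    rw [h] at this ⊢
    rw [zero_mul]
    exact le_antisymm this measureReal_nonneg
  · field_simp

theorem zero_mem_fracGroup {l q : ℕ} : (0 : ℝ) ∈ fracGroup l q := ⟨0, 0, by simp⟩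

theorem add_mem_fracGroup {l q : ℕ} {s t : ℝ} (hs : s ∈ fracGroup l q) (ht : t ∈ fracGroup l q) :
    s + t ∈ fracGroup l q := by
  obtain ⟨N, z, h⟩ := hs
  obtain ⟨N', z', h'⟩ := ht
  refine ⟨N + N', z * l ^ N' + z' * l ^ N, ?_⟩
  push_cast
  rw [← h, ← h']; ring

/-- A clopen set of measure $1/q$ is partitioned into sets $W$ of $\nu$ type. Each $\nu(W)/q$ is a
clopen value, and these add up to $1/q^2$. -/
theorem dvd_of_isOfBernoulliType [BorelSpace X] [CompactSpace X] {ν : Measure X}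
    [IsProbabilityMeasure ν] (hb : ν.IsOfBernoulliType) {l q : ℕ} (hq : 0 < q)
    (hS : ν.clopenValues = Set.Icc (0 : ℝ) 1 ∩ fracGroup l q) : ∃ K : ℕ, q ∣ l ^ K := by
  obtain ⟨𝓑, ⟨hcl, hpart⟩, htype⟩ := hb
  have hqS : (q : ℝ)⁻¹ ∈ ν.clopenValues := hS ▸ inv_natCast_mem hq
  obtain ⟨U, hU, hUq⟩ := hqS
  have hne : U.Nonempty := by
    rw [Set.nonempty_iff_ne_empty]
    rintro rfl
    rw [measureReal_empty] at hUq
    exact absurd hUq (by positivity)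
  obtain ⟨P, hPB, hd, hs⟩ := hpart U hU hne
  -- The partition is not assumed finite; compactness yields a finite subfamily that still covers
  -- `U`, so the measures can be summed.
  obtain ⟨T, hTP, hTU⟩ := hU.isClosed.isCompact.elim_finite_subcover_image
    (b := P) (c := id) (fun W hW => (hcl W (hPB hW)).isOpen)
    (by rw [← hs, Set.sUnion_eq_biUnion]; rfl)
  have hT : T.Finite := hTU.1
  have hTU := hTU.2
  have hUT : U = ⋃ W ∈ hT.toFinset, W := by
    refine Set.Subset.antisymm (by simpa using hTU) ?_
    rw [← hs]
    refine Set.iUnion₂_subset fun W hW => Set.subset_sUnion_of_mem (hTP (by simpa using hW))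
  have hsum : ν.real U = ∑ W ∈ hT.toFinset, ν.real W := by
    conv_lhs => rw [hUT]
    refine measureReal_biUnion_finset (f := id) ?_ fun W hW =>
      (hcl W (hPB (hTP (by simpa using hW)))).isOpen.measurableSet
    exact hd.subset (by simpa using hTP)
  refine exists_dvd_pow_of_inv_mul_inv_mem hq ?_
  have key : ∀ W ∈ hT.toFinset, ν.real W * (q : ℝ)⁻¹ ∈ fracGroup l q := fun W hW => by
    have h := real_mul_mem_clopenValues (htype W (hPB (hTP (by simpa using hW))))
      (t := (q : ℝ)⁻¹) ⟨U, hU, hUq⟩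
    rw [hS] at h
    exact h.2
  have h2 : (q : ℝ)⁻¹ * (q : ℝ)⁻¹ = ∑ W ∈ hT.toFinset, ν.real W * (q : ℝ)⁻¹ := by
    rw [← Finset.sum_mul, ← hsum, hUq]
  rw [h2]
  exact Finset.sum_induction _ (· ∈ fracGroup l q) (fun _ _ => add_mem_fracGroup)
    zero_mem_fracGroup key

end MeasureTheory.Measure

/-! ### Topology of the path space -/

namespace StationaryBratteliDiagram

variable {V E : Type*} {B : StationaryBratteliDiagram V E}

theorem PathSpace.vertex_succ (x : B.PathSpace) (n : ℕ) :
    x.vertex (n + 1) = B.range (x.edge n) := (x.composable n).symm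

/-- The initial segment of a path, recorded by its last vertex and its edges. -/
def PathSpace.initial (n : ℕ) (x : B.PathSpace) : V × (Fin n → E) :=
  (x.vertex n, fun i => x.edge i)

theorem PathSpace.initial_eq_iff {x x' : B.PathSpace} {n : ℕ} :
    x'.initial n = x.initial n ↔ x'.vertex n = x.vertex n ∧ ∀ i < n, x'.edge i = x.edge i := by
  simp only [PathSpace.initial, Prod.mk.injEq, funext_iff, Fin.forall_iff]

/-- Without edges the first and last vertices coincide; with at least one edge, both are determined
by the edges. The last vertex is the one that enters the measure. -/
theorem mem_cylinder_iff {x x' : B.PathSpace} {n : ℕ} :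
    x' ∈ cylinder x n ↔ x'.initial n = x.initial n := by
  rw [PathSpace.initial_eq_iff]
  refine and_congr_left fun h => ?_
  cases n with
  | zero => rfl
  | succ n =>
    rw [PathSpace.vertex_succ, PathSpace.vertex_succ, h n (Nat.lt_succ_self n)]
    simp [PathSpace.vertex, h 0 (Nat.succ_pos n)]

theorem mem_cylinder_self (x : B.PathSpace) (n : ℕ) : x ∈ cylinder x n :=
  mem_cylinder_iff.mpr rfl

theorem cylinder_eq_of_mem {x x' : B.PathSpace} {n : ℕ} (h : x' ∈ cylinder x n) :
    cylinder x' n = cylinder x n := by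
  ext z
  rw [mem_cylinder_iff, mem_cylinder_iff, mem_cylinder_iff.mp h]

theorem cylinder_anti (x : B.PathSpace) : Antitone (cylinder x) := fun _ _ hmn _ h =>
  ⟨h.1, fun i hi => h.2 i (hi.trans_le hmn)⟩

theorem isTopologicalBasis_cylinder : TopologicalSpace.IsTopologicalBasis
    {C : Set B.PathSpace | ∃ (x : B.PathSpace) (n : ℕ), C = cylinder x n} where
  exists_subset_inter := by
    rintro _ ⟨x, n, rfl⟩ _ ⟨x', n', rfl⟩ z ⟨hz, hz'⟩
    refine ⟨cylinder z (max n n'), ⟨z, _, rfl⟩, mem_cylinder_self _ _, Set.subset_inter ?_ ?_⟩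
    · rw [← cylinder_eq_of_mem hz]; exact cylinder_anti z (le_max_left _ _)
    · rw [← cylinder_eq_of_mem hz']; exact cylinder_anti z (le_max_right _ _)
  sUnion_eq := Set.eq_univ_of_forall fun x => ⟨cylinder x 0, ⟨x, 0, rfl⟩, mem_cylinder_self x 0⟩
  eq_generateFrom := rfl

theorem hasBasis_nhds (x : B.PathSpace) :
    (nhds x).HasBasis (fun _ : ℕ => True) (cylinder x) := by
  refine (isTopologicalBasis_cylinder.nhds_hasBasis (a := x)).to_hasBasis ?_ ?_
  · rintro _ ⟨⟨x', n, rfl⟩, hx⟩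
    exact ⟨n, trivial, (cylinder_eq_of_mem hx).subset⟩
  · exact fun n _ => ⟨cylinder x n, ⟨⟨x, n, rfl⟩, mem_cylinder_self x n⟩, subset_rfl⟩

theorem isOpen_preimage_initial (n : ℕ) (s : Set (V × (Fin n → E))) :
    IsOpen (PathSpace.initial (B := B) n ⁻¹' s) := by
  rw [isOpen_iff_mem_nhds]
  intro x hx
  refine (hasBasis_nhds x).mem_iff.mpr ⟨n, trivial, fun x' hx' => ?_⟩
  rwa [Set.mem_preimage, mem_cylinder_iff.mp hx']

theorem isClopen_preimage_initial (n : ℕ) (s : Set (V × (Fin n → E))) :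
    IsClopen (PathSpace.initial (B := B) n ⁻¹' s) :=
  ⟨⟨isOpen_preimage_initial n sᶜ⟩, isOpen_preimage_initial n s⟩

/-- Composability is a closed condition on pairs of neighbouring coordinates, so the path space is a
closed subspace of $E^{\mathbb N}$ and inherits compactness and second countability. -/
theorem isClosedEmbedding_edge [TopologicalSpace E] [DiscreteTopology E] :
    Topology.IsClosedEmbedding (PathSpace.edge (B := B)) := by
  refine ⟨⟨⟨le_antisymm ?_ ?_⟩, fun _ _ => PathSpace.ext⟩, ?_⟩
  · rw [← continuous_iff_le_induced]
    refine continuous_pi fun i => ?_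
    rw [continuous_discrete_rng]
    exact fun e => isOpen_preimage_initial (i + 1) {a | a.2 (Fin.last i) = e}
  · refine le_generateFrom ?_
    rintro _ ⟨x, n, rfl⟩
    have h1 : IsOpen {f : ℕ → E | B.source (f 0) = x.vertex 0} :=
      IsOpen.preimage (f := fun f : ℕ → E => f 0) (continuous_apply 0)
        (isOpen_discrete {e : E | B.source e = x.vertex 0})
    have h2 : IsOpen {f : ℕ → E | ∀ i < n, f i = x.edge i} := by
      simp only [Set.ofPred_forall]
      exact (Set.finite_lt_nat n).isOpen_biInter fun i _ =>
        IsOpen.preimage (f := fun f : ℕ → E => f i) (continuous_apply i)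
          (isOpen_discrete {x.edge i})
    exact ⟨_, h1.inter h2, rfl⟩
  · have : Set.range (PathSpace.edge (B := B))
        = ⋂ n, {f : ℕ → E | B.range (f n) = B.source (f (n + 1))} := by
      ext f
      simp only [Set.mem_range, Set.mem_iInter]
      exact ⟨fun ⟨x, hx⟩ n => hx ▸ x.composable n, fun h => ⟨⟨f, h⟩, rfl⟩⟩
    rw [this]
    refine isClosed_iInter fun n => ?_
    exact IsClosed.preimage (f := fun f : ℕ → E => (f n, f (n + 1)))
      ((continuous_apply n).prodMk (continuous_apply (n + 1)))
      (isClosed_discrete {e : E × E | B.range e.1 = B.source e.2})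

instance [Finite E] : CompactSpace B.PathSpace :=
  letI : TopologicalSpace E := ⊥
  haveI : DiscreteTopology E := ⟨rfl⟩
  isClosedEmbedding_edge.compactSpace

instance [Finite E] : SecondCountableTopology B.PathSpace :=
  letI : TopologicalSpace E := ⊥
  haveI : DiscreteTopology E := ⟨rfl⟩
  isClosedEmbedding_edge.isInducing.secondCountableTopology

/-- The path that follows `x'` down to level `n + 1` and `x` from there on. -/
def PathSpace.splice (x x' : B.PathSpace) (n : ℕ) (h : x'.vertex n = x.vertex n) :
    B.PathSpace where
  edge i := if i < n then x'.edge i else x.edge i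
  composable i := by
    rcases lt_trichotomy (i + 1) n with hi | hi | hi
    · simp [hi, (Nat.lt_succ_self i).trans hi, x'.composable i]
    · subst hi
      simp only [Nat.lt_succ_self, if_true, lt_irrefl, if_false]
      exact (x'.composable i).trans h
    · simp [show ¬ i < n by omega, show ¬ i + 1 < n by omega, x.composable i]

/-- The path obtained by putting an edge in front of a path. -/
def PathSpace.cons (e : E) (x : B.PathSpace) (h : B.range e = x.vertex 0) : B.PathSpace where
  edge i := Nat.casesOn i e x.edge
  composable i := by
    cases i with
    | zero => exact h
    | succ i => exact x.composable i

/-- The paths that agree with `x` from level `n + 1` on. -/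
def tailClass (x : B.PathSpace) (n : ℕ) : Set B.PathSpace := {x' | ∀ i ≥ n, x'.edge i = x.edge i}

theorem tailClass_mono (x : B.PathSpace) : Monotone (tailClass x) :=
  fun _ _ hmn _ h i hi => h i (hmn.trans hi)

theorem vertex_eq_of_mem_tailClass {x x' : B.PathSpace} {n : ℕ} (h : x' ∈ tailClass x n)
    {i : ℕ} (hi : n ≤ i) : x'.vertex i = x.vertex i := by
  rw [PathSpace.vertex, h i hi, PathSpace.vertex]

theorem exists_vertex_notMem_of_vertex {Z : Set V}
    (hback : ∀ e, B.source e ∈ Z → B.range e ∈ Z) {x : B.PathSpace} {n : ℕ}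
    (h : x.vertex n ∉ Z) {m : ℕ} (hm : m ≤ n) : x.vertex m ∉ Z := by
  induction n, hm using Nat.le_induction with
  | base => exact h
  | succ n _ ih =>
    refine ih fun hn => h ?_
    rw [PathSpace.vertex_succ]
    exact hback _ hn

/-! ### Tail classes and heights -/

section Saturated

/-! In this section `Z` is a set of vertices which the edges do not leave, and every vertex
outside `Z` emits an edge with range outside `Z`. -/

variable {Z : Set V}

/-- The paths that avoid the set `Z` of vertices. -/
def avoiding (B : StationaryBratteliDiagram V E) (Z : Set V) : Set B.PathSpace :=
  {x | ∀ n, x.vertex n ∉ Z}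

theorem exists_mem_avoiding_vertex_zero (hforw : ∀ v ∉ Z, ∃ e, B.source e = v ∧ B.range e ∉ Z)
    {v : V} (hv : v ∉ Z) : ∃ x ∈ avoiding B Z, x.vertex 0 = v := by
  have : Nonempty E := (hforw v hv).nonempty
  choose! g hg using hforw
  let w : ℕ → V := fun n => Nat.rec v (fun _ u => B.range (g u)) n
  have hw : ∀ n, w n ∉ Z := fun n => by
    induction n with
    | zero => exact hv
    | succ n ih => exact (hg _ ih).2
  have hs : ∀ n, B.source (g (w n)) = w n := fun n => (hg _ (hw n)).1
  refine ⟨⟨fun n => g (w n), fun n => (hs (n + 1)).symm⟩, fun n => ?_, hs 0⟩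
  change B.source (g (w n)) ∉ Z
  rw [hs]
  exact hw n

theorem exists_mem_avoiding_vertex (hback : ∀ e, B.source e ∈ Z → B.range e ∈ Z)
    (hforw : ∀ v ∉ Z, ∃ e, B.source e = v ∧ B.range e ∉ Z)
    {v : V} (hv : v ∉ Z) (n : ℕ) : ∃ x ∈ avoiding B Z, x.vertex n = v := by
  induction n with
  | zero => exact exists_mem_avoiding_vertex_zero hforw hv
  | succ n ih =>
    obtain ⟨x, hx, hxv⟩ := ih
    -- By stationarity, putting an edge in front shifts a path down one level; its source avoids `Z`
    -- because edges do not leave `Z`.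
    obtain ⟨e, he⟩ := B.range_surjective (x.vertex 0)
    refine ⟨x.cons e he, fun m => ?_, hxv⟩
    cases m with
    | zero => exact fun h => hx 0 (he ▸ hback e h)
    | succ m => exact hx m

theorem isClosed_avoiding (B : StationaryBratteliDiagram V E) (Z : Set V) :
    IsClosed (avoiding B Z) := by
  have : avoiding B Z = ⋂ n, PathSpace.initial (B := B) n ⁻¹' {a | a.1 ∉ Z} := by
    ext x
    simp [avoiding, PathSpace.initial]
  rw [this]
  exact isClosed_iInter fun n => (isClopen_preimage_initial n _).isClosed

variable [Fintype V] [Fintype E]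

open Classical in
/-- The initial segments of the paths that avoid `Z`. -/
noncomputable def segments (B : StationaryBratteliDiagram V E) (Z : Set V) (n : ℕ) :
    Finset (V × (Fin n → E)) :=
  (PathSpace.initial n '' avoiding B Z).toFinset

theorem mem_segments {n : ℕ} {a : V × (Fin n → E)} :
    a ∈ segments B Z n ↔ ∃ x ∈ avoiding B Z, x.initial n = a := by
  simp [segments]

open Classical in
/-- The number of initial segments that avoid `Z` and lead to a given vertex. -/
noncomputable def height (B : StationaryBratteliDiagram V E) (Z : Set V) (n : ℕ) (v : V) : ℕ :=
  ((segments B Z n).filter fun a => a.1 = v).card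

/-- Any segment that ends at `x.vertex n` can be spliced onto the tail of `x`, so the height counts
the tail class. -/
theorem initial_bijOn_tailClass (hback : ∀ e, B.source e ∈ Z → B.range e ∈ Z) {x : B.PathSpace}
    (hx : x ∈ avoiding B Z) (n : ℕ) :
    Set.BijOn (PathSpace.initial n) (tailClass x n) {a | a ∈ segments B Z n ∧ a.1 = x.vertex n} := by
  refine ⟨fun x' hx' => ⟨mem_segments.mpr ⟨x', fun m => ?_, rfl⟩,
    vertex_eq_of_mem_tailClass hx' le_rfl⟩, fun x₁ h₁ x₂ h₂ h => ?_, ?_⟩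
  · rcases le_total n m with hm | hm
    · rw [vertex_eq_of_mem_tailClass hx' hm]
      exact hx m
    · exact exists_vertex_notMem_of_vertex hback
        (by rw [vertex_eq_of_mem_tailClass hx' le_rfl]; exact hx n) hm
  · ext i
    rcases lt_or_ge i n with hi | hi
    · exact (PathSpace.initial_eq_iff.mp h).2 i hi
    · rw [h₁ i hi, h₂ i hi]
  · rintro a ⟨ha, hav⟩
    obtain ⟨x', -, rfl⟩ := mem_segments.mp ha
    have hmem : x.splice x' n hav ∈ tailClass x n := fun i hi => if_neg (not_lt.mpr hi)
    refine ⟨x.splice x' n hav, hmem, PathSpace.initial_eq_iff.mpr ⟨?_, fun i hi => if_pos hi⟩⟩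
    rw [vertex_eq_of_mem_tailClass hmem le_rfl]
    exact hav.symm

theorem finite_tailClass (hback : ∀ e, B.source e ∈ Z → B.range e ∈ Z) {x : B.PathSpace}
    (hx : x ∈ avoiding B Z) (n : ℕ) : (tailClass x n).Finite :=
  (initial_bijOn_tailClass hback hx n).finite_iff_finite.mpr (Set.toFinite _)

theorem ncard_tailClass (hback : ∀ e, B.source e ∈ Z → B.range e ∈ Z) {x : B.PathSpace}
    (hx : x ∈ avoiding B Z) (n : ℕ) : (tailClass x n).ncard = height B Z n (x.vertex n) := by
  classical
  rw [← (initial_bijOn_tailClass hback hx n).injOn.ncard_image,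
    (initial_bijOn_tailClass hback hx n).image_eq, height, ← Set.ncard_coe_finset]
  congr 1
  ext a
  simp

theorem exists_le_ncard_tailClass (hback : ∀ e, B.source e ∈ Z → B.range e ∈ Z)
    {x : B.PathSpace} (hx : x ∈ avoiding B Z) (hinf : {x' | TailEquiv x x'}.Infinite) (C : ℕ) :
    ∃ n, C ≤ (tailClass x n).ncard := by
  obtain ⟨t, ht, htC⟩ := hinf.exists_subset_card_eq C
  have ht' : ∀ x' ∈ t, ∃ n, x' ∈ tailClass x n := fun x' hx' => by
    obtain ⟨n, hn⟩ := ht hx'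
    exact ⟨n, fun i hi => (hn i hi).symm⟩
  choose! g hg using ht'
  refine ⟨t.sup g, ?_⟩
  rw [← htC, ← Set.ncard_coe_finset]
  exact Set.ncard_le_ncard (fun x' hx' => tailClass_mono x (Finset.le_sup hx') (hg x' hx'))
    (finite_tailClass hback hx _)

/-- If the tail classes of the paths that avoid `Z` are infinite, then the heights of the
vertices outside `Z` tend to infinity. -/
theorem exists_le_height (hback : ∀ e, B.source e ∈ Z → B.range e ∈ Z)
    (hforw : ∀ v ∉ Z, ∃ e, B.source e = v ∧ B.range e ∉ Z)
    (hinf : ∀ x ∈ avoiding B Z, {x' | TailEquiv x x'}.Infinite) (C : ℕ) :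
    ∃ n, ∀ m ≥ n, ∀ v ∉ Z, C ≤ height B Z m v := by
  -- The sets `O n` are open, increase along the avoiding paths and cover them, since tail classes
  -- are infinite; compactness makes the level uniform.
  let O : ℕ → Set B.PathSpace := fun n => PathSpace.initial n ⁻¹' {a | C ≤ height B Z n a.1}
  have hO : ∀ x ∈ avoiding B Z, ∀ n, x ∈ O n ↔ C ≤ (tailClass x n).ncard := fun x hx n => by
    rw [ncard_tailClass hback hx]
    rfl
  have hmono : ∀ x ∈ avoiding B Z, ∀ m n, m ≤ n → x ∈ O m → x ∈ O n := fun x hx m n hmn h => by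
    rw [hO x hx] at h ⊢
    exact h.trans (Set.ncard_le_ncard (tailClass_mono x hmn) (finite_tailClass hback hx n))
  obtain ⟨T, hT⟩ := (isClosed_avoiding B Z).isCompact.elim_finite_subcover O
    (fun n => isOpen_preimage_initial n _) fun x hx => by
      obtain ⟨n, hn⟩ := exists_le_ncard_tailClass hback hx (hinf x hx) C
      exact Set.mem_iUnion.mpr ⟨n, (hO x hx n).mpr hn⟩
  refine ⟨T.sup id, fun m hm v hv => ?_⟩
  obtain ⟨x, hx, rfl⟩ := exists_mem_avoiding_vertex hback hforw hv m
  obtain ⟨n, hn, hxn⟩ := Set.mem_iUnion₂.mp (hT hx)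
  exact hmono x hx n m ((Finset.le_sup (f := id) hn).trans hm) hxn

end Saturated

end StationaryBratteliDiagram

/-! ### The measure on its support -/

namespace MeasureTheory.Measure

variable {X : Type*} [TopologicalSpace X] [MeasurableSpace X] [BorelSpace X]

theorem onSupport_apply (μ : Measure X) (U : Set μ.support) :
    μ.onSupport U = μ (Subtype.val '' U) :=
  (MeasurableEmbedding.subtype_coe μ.isClosed_support.measurableSet).comap_apply μ U

variable [SecondCountableTopology X]

theorem onSupport_preimage_val (μ : Measure X) (O : Set X) :
    μ.onSupport (Subtype.val ⁻¹' O) = μ O := by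
  rw [onSupport_apply, Subtype.image_preimage_coe, Set.inter_comm]
  exact measure_inter_conull measure_compl_support

instance (μ : Measure X) [IsProbabilityMeasure μ] : IsProbabilityMeasure μ.onSupport :=
  ⟨by rw [← Set.preimage_univ (f := Subtype.val), onSupport_preimage_val, measure_univ]⟩

instance (μ : Measure X) : μ.onSupport.IsOpenPosMeasure where
  open_pos := by
    rintro _ ⟨O, hO, rfl⟩ ⟨x, hx⟩
    rw [onSupport_preimage_val]
    exact ((mem_support_iff_forall x.1).mp x.2 O (hO.mem_nhds hx)).ne'

end MeasureTheory.Measure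

/-! ### Eigenvectors, supports and clopen sets -/

namespace StationaryBratteliDiagram

variable {V E : Type*} [Fintype V] [Fintype E] {B : StationaryBratteliDiagram V E} {lam : ℝ}
  {y : V → ℝ}

namespace IsProbabilityEigenvector

open Classical in
theorem sum_range (hy : B.IsProbabilityEigenvector lam y) (w : V) :
    ∑ e with B.source e = w, y (B.range e) = lam * y w := by
  have h := congrFun hy.eigen w
  simp only [Matrix.mulVec, dotProduct, Matrix.transpose_apply, Matrix.map_apply, Pi.smul_apply,
    smul_eq_mul] at h
  rw [← h, ← Finset.sum_fiberwise (Finset.univ.filter fun e => B.source e = w) B.range]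
  refine Finset.sum_congr rfl fun v _ => ?_
  rw [Finset.sum_congr rfl fun e he => by rw [(Finset.mem_filter.mp he).2], Finset.sum_const,
    nsmul_eq_mul, incidence, Nat.card_eq_fintype_card, Fintype.card_subtype, Finset.filter_filter]
  simp only [and_comm]

/-- Non-negative terms with a non-positive sum vanish. The inequality covers both `lam ≤ 0` and `y
(B.source e) = 0`. -/
theorem range_eq_zero (hy : B.IsProbabilityEigenvector lam y) {e : E}
    (he : lam * y (B.source e) ≤ 0) : y (B.range e) = 0 := by
  classical
  rw [← hy.sum_range] at he
  exact (Finset.sum_eq_zero_iff_of_nonneg fun e _ => hy.nonneg _).mp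
    (le_antisymm he (Finset.sum_nonneg fun e _ => hy.nonneg _)) e (by simp)

theorem lam_pos (hy : B.IsProbabilityEigenvector lam y) : 0 < lam := by
  by_contra! h
  have h0 : ∀ v, y v = 0 := fun v => by
    obtain ⟨e, rfl⟩ := B.range_surjective v
    exact hy.range_eq_zero (mul_nonpos_of_nonpos_of_nonneg h (hy.nonneg _))
  simpa [h0] using hy.sum_eq_one

theorem range_mem_zeros (hy : B.IsProbabilityEigenvector lam y) (e : E)
    (he : B.source e ∈ {v | y v = 0}) : B.range e ∈ {v | y v = 0} := by
  have he' : y (B.source e) = 0 := he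
  exact hy.range_eq_zero (by rw [he', mul_zero])

theorem exists_range_notMem_zeros (hy : B.IsProbabilityEigenvector lam y) (v : V)
    (hv : v ∉ {v | y v = 0}) : ∃ e, B.source e = v ∧ B.range e ∉ {v | y v = 0} := by
  classical
  have h : ∑ e with B.source e = v, y (B.range e) ≠ 0 := by
    rw [hy.sum_range]
    exact mul_ne_zero hy.lam_pos.ne' hv
  obtain ⟨e, he, hne⟩ := Finset.exists_ne_zero_of_sum_ne_zero h
  exact ⟨e, by simpa using he, hne⟩

end IsProbabilityEigenvector

theorem support_eq_avoiding (hy : B.IsProbabilityEigenvector lam y) {μ : Measure B.PathSpace}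
    (hμ : IsDefinedBy μ lam y) : μ.support = avoiding B {v | y v = 0} := by
  ext x
  rw [(hasBasis_nhds x).mem_measureSupport]
  refine forall_congr' fun n => ?_
  rw [hμ, ENNReal.ofReal_pos, div_pos_iff_of_pos_right (pow_pos hy.lam_pos n), forall_const]
  exact (hy.nonneg _).lt_iff_ne'

/-- The measure of a union of cylinders of the same level. -/
theorem onSupport_real_preimage_initial (hy : B.IsProbabilityEigenvector lam y)
    {μ : Measure B.PathSpace} [IsProbabilityMeasure μ] (hμ : IsDefinedBy μ lam y) (n : ℕ)
    (s : Finset (V × (Fin n → E))) (hs : s ⊆ segments B {v | y v = 0} n) :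
    μ.onSupport.real (Subtype.val ⁻¹' (PathSpace.initial n ⁻¹' (s : Set (V × (Fin n → E)))))
      = (∑ a ∈ s, y a.1) / lam ^ n := by
  rw [measureReal_def, Measure.onSupport_preimage_val, ← measureReal_def]
  have h : PathSpace.initial n ⁻¹' (s : Set (V × (Fin n → E)))
      = ⋃ a ∈ s, PathSpace.initial (B := B) n ⁻¹' {a} := by
    ext x
    simp
  rw [h, measureReal_biUnion_finset, Finset.sum_div]
  · refine Finset.sum_congr rfl fun a ha => ?_
    obtain ⟨x, -, rfl⟩ := mem_segments.mp (hs ha)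
    have : PathSpace.initial n ⁻¹' {x.initial n} = cylinder x n :=
      Set.ext fun x' => mem_cylinder_iff.symm
    rw [this, measureReal_def, hμ, ENNReal.toReal_ofReal]
    · rfl
    · exact div_nonneg (hy.nonneg _) (pow_nonneg hy.lam_pos.le n)
  · intro a _ b _ hab
    exact Disjoint.preimage _ (Set.disjoint_singleton.mpr hab)
  · exact fun a _ => (isOpen_preimage_initial n _).measurableSet

theorem onSupport_preimage_segments (hy : B.IsProbabilityEigenvector lam y)
    {μ : Measure B.PathSpace} (hμ : IsDefinedBy μ lam y) (n : ℕ) :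
    (Subtype.val ⁻¹' (PathSpace.initial n ⁻¹'
      (segments B {v | y v = 0} n : Set (V × (Fin n → E)))) : Set μ.support) = Set.univ := by
  refine Set.eq_univ_of_forall fun x => ?_
  exact mem_segments.mpr ⟨x, support_eq_avoiding hy hμ ▸ x.2, rfl⟩

/-- Each point of `U` has a cylinder whose trace on the support lies in `U`; by compactness one
level serves for all points. -/
theorem exists_eq_preimage_initial (hy : B.IsProbabilityEigenvector lam y)
    {μ : Measure B.PathSpace} (hμ : IsDefinedBy μ lam y) {U : Set μ.support} (hU : IsClopen U) :
    ∃ (n : ℕ) (s : Finset (V × (Fin n → E))), s ⊆ segments B {v | y v = 0} n ∧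
      U = Subtype.val ⁻¹' (PathSpace.initial n ⁻¹' (s : Set (V × (Fin n → E)))) := by
  classical
  let O : ℕ → Set μ.support := fun n =>
    Subtype.val ⁻¹' (PathSpace.initial n ⁻¹' {a | ∀ x : μ.support, x.1.initial n = a → x ∈ U})
  have hOmono : ∀ m n, m ≤ n → O m ⊆ O n := fun m n hmn x hx x' hx' =>
    hx x' (mem_cylinder_iff.mp (cylinder_anti x.1 hmn (mem_cylinder_iff.mpr hx')))
  have : CompactSpace μ.support := isCompact_iff_compactSpace.mp μ.isClosed_support.isCompact
  obtain ⟨T, hT⟩ := hU.isClosed.isCompact.elim_finite_subcover O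
    (fun n => (isOpen_preimage_initial n _).preimage continuous_subtype_val) fun x hx => by
      obtain ⟨W, hW, rfl⟩ := isOpen_induced_iff.mp hU.isOpen
      obtain ⟨n, -, hn⟩ := (hasBasis_nhds x.1).mem_iff.mp (hW.mem_nhds hx)
      exact Set.mem_iUnion.mpr ⟨n, fun x' hx' => hn (mem_cylinder_iff.mpr hx')⟩
  have hUO : ∀ x ∈ U, x ∈ O (T.sup id) := fun x hx => by
    obtain ⟨m, hm, hxm⟩ := Set.mem_iUnion₂.mp (hT hx)
    exact hOmono m _ (Finset.le_sup (f := id) hm) hxm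
  refine ⟨T.sup id, ((fun x : μ.support => x.1.initial (T.sup id)) '' U).toFinset, ?_, ?_⟩
  · intro a ha
    obtain ⟨x, -, rfl⟩ := Set.mem_toFinset.mp ha
    exact mem_segments.mpr ⟨x, support_eq_avoiding hy hμ ▸ x.2, rfl⟩
  · ext x
    simp only [Set.coe_toFinset, Set.mem_preimage, Set.mem_image]
    exact ⟨fun hx => ⟨x, hx, rfl⟩, fun ⟨x', hx', h⟩ => hUO x' hx' x h.symm⟩

/-! ### The clopen values computed from the reduced vector -/

section Reduced

variable {n : ℕ} {p : Fin n → ℕ} {q : ℕ}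

open Classical in
/-- A sum of entries of `y` expressed through the reduced vector. -/
theorem sum_eq_sum_card_mul {α : Type*} (s : Finset α) (g : α → V)
    (f : Fin n ≃ {v : V // y v ≠ 0}) (hf : ∀ i, (p i : ℝ) / q = y (f i)) :
    ∑ a ∈ s, y (g a) = ((∑ i, (s.filter fun a => g a = f i).card * p i : ℕ) : ℝ) / q := by
  have h1 : ∑ a ∈ s, y (g a) = ∑ v, ((s.filter fun a => g a = v).card : ℝ) * y v := by
    rw [← Finset.sum_fiberwise s g]
    refine Finset.sum_congr rfl fun v _ => ?_
    rw [Finset.sum_congr rfl fun a ha => by rw [(Finset.mem_filter.mp ha).2], Finset.sum_const,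
      nsmul_eq_mul]
  have h2 : ∑ v, ((s.filter fun a => g a = v).card : ℝ) * y v
      = ∑ v : {v : V // y v ≠ 0}, ((s.filter fun a => g a = v).card : ℝ) * y v := by
    rw [← Finset.sum_subtype (Finset.univ.filter fun v => y v ≠ 0) (by simp)
      fun v => ((s.filter fun a => g a = v).card : ℝ) * y v]
    exact (Finset.sum_filter_of_ne fun v _ h => right_ne_zero_of_mul h).symm
  rw [h1, h2, ← f.sum_comp]
  push_cast
  rw [Finset.sum_div]
  exact Finset.sum_congr rfl fun i _ => by rw [← hf, mul_div_assoc]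

theorem exists_lam_eq_natCast (hy : B.IsProbabilityEigenvector lam y) (hq : 0 < q)
    (f : Fin n ≃ {v : V // y v ≠ 0}) (hf : ∀ i, (p i : ℝ) / q = y (f i))
    (hgcd : Finset.univ.gcd p = 1) : ∃ l : ℕ, 0 < l ∧ lam = l := by
  classical
  have hq' : (q : ℝ) ≠ 0 := by positivity
  have h : ∀ i, ∃ m : ℕ, lam * p i = m := fun i => by
    have h1 := hy.sum_range (f i)
    rw [sum_eq_sum_card_mul _ B.range f hf, ← hf] at h1
    field_simp at h1
    exact ⟨_, h1.symm⟩
  choose m hm using h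
  obtain ⟨a, ha⟩ := exists_int_sum_mul_eq_one p hgcd
  have hl : lam = ((∑ i, a i * m i : ℤ) : ℝ) := by
    have ha' : ∑ i, (a i : ℝ) * p i = 1 := by exact_mod_cast ha
    push_cast
    rw [← mul_one lam, ← ha', Finset.mul_sum]
    exact Finset.sum_congr rfl fun i _ => by rw [← hm]; ring
  have hpos : 0 < ∑ i, a i * (m i : ℤ) := by
    have := hy.lam_pos
    rw [hl] at this
    exact_mod_cast this
  generalize ∑ i, a i * (m i : ℤ) = k at hl hpos
  lift k to ℕ using hpos.le
  exact ⟨k, by exact_mod_cast hpos, by simpa using hl⟩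

theorem clopenValues_onSupport {l : ℕ} (hl : 0 < l) (hy : B.IsProbabilityEigenvector (l : ℝ) y)
    {μ : Measure B.PathSpace} [IsProbabilityMeasure μ] (hμ : IsDefinedBy μ (l : ℝ) y)
    (haper : ∀ x ∈ μ.support, {x' | TailEquiv x x'}.Infinite) (hq : 0 < q)
    (f : Fin n ≃ {v : V // y v ≠ 0}) (hf : ∀ i, (p i : ℝ) / q = y (f i))
    (hgcd : Finset.univ.gcd p = 1) :
    μ.onSupport.clopenValues = Set.Icc (0 : ℝ) 1 ∩ fracGroup l q := by
  classical
  have hq' : (q : ℝ) ≠ 0 := by positivity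
  have hlpos : ∀ N, 0 < (l : ℝ) ^ N := fun N => by positivity
  refine Set.Subset.antisymm ?_ ?_
  · rintro _ ⟨U, hU, rfl⟩
    refine ⟨⟨measureReal_nonneg, measureReal_le_one⟩, ?_⟩
    obtain ⟨N, s, hs, rfl⟩ := exists_eq_preimage_initial hy hμ hU
    rw [onSupport_real_preimage_initial hy hμ N s hs, sum_eq_sum_card_mul s Prod.fst f hf]
    refine ⟨N, ((∑ i, (s.filter fun a => a.1 = (f i : V)).card * p i : ℕ) : ℤ), ?_⟩
    rw [div_mul_cancel₀ _ (hlpos N).ne', div_mul_cancel₀ _ hq', Int.cast_natCast]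
  have hinf := support_eq_avoiding hy hμ ▸ haper
  have hheight := exists_le_height hy.range_mem_zeros hy.exists_range_notMem_zeros hinf
  -- The cylinders of one level exhaust the support, which has measure one.
  have htotal : ∀ N, ∑ i, height B {v | y v = 0} N (f i) * p i = l ^ N * q := fun N => by
    have h := onSupport_real_preimage_initial hy hμ N _ subset_rfl
    rw [onSupport_preimage_segments hy hμ, probReal_univ, sum_eq_sum_card_mul _ Prod.fst f hf] at h
    have h' := h.symm
    rw [div_div, div_eq_one_iff_eq (mul_ne_zero hq' (hlpos N).ne')] at h'
    rw [mul_comm (l ^ N)]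
    exact_mod_cast h'
  have hppos : ∀ i, 0 < p i := fun i => Nat.pos_of_ne_zero fun h0 => by
    have := hf i
    rw [h0, Nat.cast_zero, zero_div] at this
    exact (f i).2 this.symm
  have hpow : ∀ C : ℕ, ∃ N, ∀ M ≥ N, C ≤ l ^ M := fun C => by
    obtain ⟨N, hN⟩ := hheight (C * q)
    refine ⟨N, fun M hM => Nat.le_of_mul_le_mul_right ?_ hq⟩
    -- The index set is non-empty because an empty gcd is `0`.
    obtain ⟨i, -⟩ : (Finset.univ : Finset (Fin n)).Nonempty := by
      rw [Finset.nonempty_iff_ne_empty]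
      intro h
      simp [h] at hgcd
    rw [← htotal]
    exact (hN M hM _ (f i).2).trans ((Nat.le_mul_of_pos_right _ (hppos i)).trans
      (Finset.single_le_sum (f := fun i => height B {v | y v = 0} M (f i) * p i)
        (fun _ _ => Nat.zero_le _) (Finset.mem_univ i)))
  rintro t ⟨⟨ht0, ht1⟩, N, z, hz⟩
  rcases ht0.eq_or_lt with rfl | ht0
  · exact ⟨∅, isClopen_empty, by simp⟩
  rcases ht1.eq_or_lt with rfl | ht1
  · exact ⟨Set.univ, isClopen_univ, by simp⟩
  obtain ⟨C, hC⟩ := exists_bounded_sum_mul_eq p hgcd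
  have hz0 : 0 < z := by
    have : (0 : ℝ) < z := by rw [← hz]; positivity
    exact_mod_cast this
  have hz1 : z < l ^ N * q := by
    have : (z : ℝ) < l ^ N * q := by
      rw [← hz, mul_assoc]
      exact mul_lt_of_lt_one_left (by positivity) ht1
    exact_mod_cast this
  lift z to ℕ using hz0.le
  obtain ⟨N₁, hN₁⟩ := hheight C
  obtain ⟨N₂, hN₂⟩ := hpow C
  set M := max N₁ N₂ with hM
  have hM' : C ≤ l ^ M := hN₂ M (le_max_right _ _)
  have hCM : ∀ v ∉ {v | y v = 0}, C ≤ height B {v | y v = 0} (N + M) v :=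
    hN₁ (N + M) (le_trans (le_max_left _ _) (Nat.le_add_left _ _))
  have hz0' : 1 ≤ z := by exact_mod_cast hz0
  have hz1' : z + 1 ≤ l ^ N * q := by exact_mod_cast hz1
  -- At level `N + M` the numerator is `z * l ^ M` out of `l ^ N * q * l ^ M`. As `1 ≤ z` and `z + 1
  -- ≤ l ^ N * q`, it is at least `l ^ M ≥ C` away from both ends.
  obtain ⟨k, hk, hkz⟩ := hC (fun i => height B {v | y v = 0} (N + M) (f i))
    (fun i => hCM _ (f i).2) (z * l ^ M) (by nlinarith) (by
      rw [htotal, pow_add]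
      nlinarith [Nat.mul_le_mul_right (l ^ M) hz1'])
  -- The clopen set is the union of `k i` cylinders chosen among those that end at `f i`.
  have hex : ∀ i, ∃ s ⊆ (segments B {v | y v = 0} (N + M)).filter fun a => a.1 = (f i : V),
      s.card = k i := fun i => Finset.exists_subset_card_eq (hk i)
  choose s hs hsk using hex
  have hfib : ∀ i, ((Finset.univ.biUnion s).filter fun a => a.1 = (f i : V)) = s i := fun i => by
    ext a
    simp only [Finset.mem_filter, Finset.mem_biUnion, Finset.mem_univ, true_and]
    refine ⟨?_, fun ha => ⟨⟨i, ha⟩, (Finset.mem_filter.mp (hs i ha)).2⟩⟩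
    rintro ⟨⟨j, hj⟩, hai⟩
    have hij : f j = f i := Subtype.ext ((Finset.mem_filter.mp (hs j hj)).2.symm.trans hai)
    rwa [← f.injective hij]
  refine ⟨_, (isClopen_preimage_initial (N + M) _).preimage continuous_subtype_val,
    (onSupport_real_preimage_initial hy hμ (N + M) (Finset.univ.biUnion s) ?_).trans ?_⟩
  · exact Finset.biUnion_subset.mpr fun i _ => (hs i).trans (Finset.filter_subset _ _)
  · rw [sum_eq_sum_card_mul _ Prod.fst f hf]
    simp only [hfib, hsk, hkz]
    rw [div_div, div_eq_iff (mul_ne_zero hq' (hlpos _).ne'), Nat.cast_mul, Nat.cast_pow]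
    rw [Int.cast_natCast] at hz
    rw [← hz, pow_add]
    ring

end Reduced

end StationaryBratteliDiagram

theorem mainTheorem6 {V E : Type*} [Fintype V] [Fintype E] (B : StationaryBratteliDiagram V E)
    (μ : Measure B.PathSpace) [IsProbabilityMeasure μ]
    (haper : ∀ x ∈ μ.support, {x' | StationaryBratteliDiagram.TailEquiv x x'}.Infinite)
    (lam : ℝ) (y : V → ℝ) (hy : B.IsProbabilityEigenvector lam y)
    (hμ : StationaryBratteliDiagram.IsDefinedBy μ lam y)
    (hrat : μ.onSupport.IsRational)
    (n : ℕ) (p : Fin n → ℕ) (q : ℕ) (hq : 0 < q)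
    (hp : IsReducedVector y (fun i => (p i : ℝ) / (q : ℝ)))
    (hgcd : Finset.univ.gcd p = 1) :
    ∃ l : ℕ, 0 < l ∧ lam = (l : ℝ) ∧
      (∀ t : ℝ, (∃ s ∈ μ.onSupport.clopenValues, ∃ k : ℤ, t = s + (k : ℝ)) ↔
        ∃ N : ℕ, ∃ z : ℤ, t * lam ^ N * (q : ℝ) = (z : ℝ)) ∧
      ((∀ s ∈ μ.onSupport.clopenValues, ∀ t ∈ μ.onSupport.clopenValues,
          s * t ∈ μ.onSupport.clopenValues) ↔
        ∃ K : ℕ, q ∣ l ^ K) ∧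
      (μ.onSupport.IsGood →
        (μ.onSupport.IsOfBernoulliType ↔ ∃ K : ℕ, q ∣ l ^ K)) := by
  obtain ⟨f, hf⟩ := hp
  obtain ⟨l, hl, rfl⟩ := StationaryBratteliDiagram.exists_lam_eq_natCast hy hq f hf hgcd
  have hS := StationaryBratteliDiagram.clopenValues_onSupport hl hy hμ haper hq f hf hgcd
  have : CompactSpace μ.support := isCompact_iff_compactSpace.mp μ.isClosed_support.isCompact
  refine ⟨l, hl, rfl, fun t => ?_, ?_, fun hg => ⟨fun hb => ?_, fun ⟨K, hK⟩ => ?_⟩⟩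
  · rw [hS]
    exact exists_add_int_iff_mem_fracGroup t
  · rw [hS]
    exact mul_mem_fracGroup_iff hq hl
  · exact Measure.dvd_of_isOfBernoulliType hb hq hS
  · exact Measure.isOfBernoulliType_of_dvd hg hl hq hK hS
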